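/- Let $S^1=\mathbb R/\mathbb Z$. For $\beta\in\mathbb R$ let $\phi_\beta:S^1\to S^1$, $\phi_\beta(\theta)=\theta+\beta$, be the rotation by $\beta$, let $\Theta_\beta=(S^1\times[0,1])/\!\sim$ with $(\theta,1)\sim(\theta+\beta,0)$ be its mapping torus (with the quotient topology), and let $\phi_\beta^t(\theta,r)=(\theta+\lfloor r+t\rfloor\beta,\; r+t \bmod 1)$, $t\in\mathbb R$, be the suspension flow by $\beta$ on $\Theta_\beta$. A discrete-time cocycle in $\mathrm{SL}_d(\mathbb R)$ over $\phi_\alpha$ is a continuous map $A:S^1\to\mathrm{SL}_d(\mathbb R)$, $\theta\mapsto A_\theta$; its $n$-step map is $A^n_\theta=A_{\theta+(n-1)\alpha}\cdots A_{\theta+\alpha}A_\theta$ for $n>0$, $A^0_\theta=\mathrm{Id}$, and $A^n_\theta=A_{\theta+n\alpha}^{-1}\cdots A_{\theta-2\alpha}^{-1}A_{\theta-\alpha}^{-1}$ for $n<0$. A continuous-time cocycle in $\mathrm{SL}_d(\mathbb R)$ over the suspension flow by $\beta$ is a continuous map $\Phi:\Theta_\beta\times\mathbb R\to\mathrm{SL}_d(\mathbb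 R)$, $(x,t)\mapsto\Phi^t_x$, that is generated by some continuous map $G:\Theta_\beta\to\mathfrak{sl}_d(\mathbb R)$ into the real trace-zero $d\times d$ matrices, in the sense that $\Phi^0_x=\mathrm{Id}$ and $\partial_t\Phi^t_x=G(\phi_\beta^t(x))\,\Phi^t_x$ for all $x\in\Theta_\beta$ and $t\in\mathbb R$; it then satisfies $\Phi^{s+t}_x=\Phi^t_{\phi_\beta^s(x)}\Phi^s_x$ for all $s,t\in\mathbb R$. **Corollary.** Let $d\ge 3$, let $\alpha\in\mathbb R$, and let $A$ be a discrete-time cocycle in $\mathrm{SL}_d(\mathbb R)$ over the circle rotation $\phi_\alpha$. Then there is a continuous-time cocycle $\Phi$ in $\mathrm{SL}_d(\mathbb R)$ over the suspension flow by $\tfrac12\alpha$ such that $$\Phi^n_{(\theta,0)}=A^n_{2\theta}\qquad\text{for all } n\in\mathbb Z \text{ and all } \theta\in S^1 .$$ -/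

import Mathlib

open scoped MatrixGroups

/-! ### Discrete-time cocycles -/

/-- `A_{φ^{n-1} θ} ⋯ A_{φ θ} A_θ`, the product of `n` factors. -/
def nStepForward {Θ : Type*} [TopologicalSpace Θ] {d : ℕ} (φ : Θ ≃ₜ Θ) (A : C(Θ, SL(d, ℝ))) :
    ℕ → Θ → SL(d, ℝ)
  | 0, _ => 1
  | n + 1, θ => A ((φ ^ n) θ) * nStepForward φ A n θ

/-- `A_{φ^{-n} θ}⁻¹ ⋯ A_{φ^{-2} θ}⁻¹ A_{φ^{-1} θ}⁻¹`, the product of `n` factors. -/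
def nStepBackward {Θ : Type*} [TopologicalSpace Θ] {d : ℕ} (φ : Θ ≃ₜ Θ) (A : C(Θ, SL(d, ℝ))) :
    ℕ → Θ → SL(d, ℝ)
  | 0, _ => 1
  | n + 1, θ => (A ((φ ^ (-((n : ℤ) + 1))) θ))⁻¹ * nStepBackward φ A n θ

/-- The `n`-step map `A^n_θ`, `n ∈ ℤ`, of the discrete-time cocycle over the homeomorphism `φ`
generated by the continuous map `A`. -/
def nStep {Θ : Type*} [TopologicalSpace Θ] {d : ℕ} (φ : Θ ≃ₜ Θ) (A : C(Θ, SL(d, ℝ))) :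
    ℤ → Θ → SL(d, ℝ)
  | Int.ofNat n, θ => nStepForward φ A n θ
  | Int.negSucc n, θ => nStepBackward φ A (n + 1) θ

/-! ### The mapping torus and the suspension flow -/

/-- The gluing `(θ, 1) ∼ (φ θ, 0)` on `Θ × [0, 1]`. -/
inductive MappingTorusRel {Θ : Type*} [TopologicalSpace Θ] (φ : Θ ≃ₜ Θ) :
    Θ × unitInterval → Θ × unitInterval → Prop
  | glue (θ : Θ) : MappingTorusRel φ (θ, 1) (φ θ, 0)

/-- The mapping torus `Θ₁ = (Θ × [0, 1]) / ∼`: the quotient by the equivalence relation generated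
by the gluing. -/
def MappingTorus {Θ : Type*} [TopologicalSpace Θ] (φ : Θ ≃ₜ Θ) : Type _ :=
  Quot (MappingTorusRel φ)

/-- The quotient topology. -/
instance {Θ : Type*} [TopologicalSpace Θ] (φ : Θ ≃ₜ Θ) : TopologicalSpace (MappingTorus φ) :=
  inferInstanceAs (TopologicalSpace (Quot (MappingTorusRel φ)))

/-- The class of `(θ, r)` in the mapping torus. -/
def MappingTorus.mk {Θ : Type*} [TopologicalSpace Θ] (φ : Θ ≃ₜ Θ) (θ : Θ) (r : unitInterval) :
    MappingTorus φ :=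
  Quot.mk _ (θ, r)

/-- The suspension flow `φ^t (θ, r) = (φ^⌊r + t⌋ θ, r + t mod 1)` on the mapping torus. -/
noncomputable def suspensionFlow {Θ : Type*} [TopologicalSpace Θ] (φ : Θ ≃ₜ Θ) (t : ℝ) :
    MappingTorus φ → MappingTorus φ :=
  Quot.lift
    (fun p => MappingTorus.mk φ ((φ ^ ⌊(p.2 : ℝ) + t⌋) p.1)
      ⟨Int.fract ((p.2 : ℝ) + t), Int.fract_nonneg _, (Int.fract_lt_one _).le⟩)
    (by
      rintro _ _ ⟨θ⟩
      have h1 : ⌊((1 : unitInterval) : ℝ) + t⌋ = ⌊((0 : unitInterval) : ℝ) + t⌋ + 1 := by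
        simp [add_comm]
      have h2 : Int.fract (((1 : unitInterval) : ℝ) + t) =
          Int.fract (((0 : unitInterval) : ℝ) + t) := by
        simp
      simp only [h1, h2, zpow_add_one]
      rfl)

/-! ### Continuous-time cocycles -/

/-- A continuous-time cocycle in `SL_d(ℝ)` over the suspension flow of `φ`: a continuous generator
`G : Θ₁ → 𝔰𝔩_d(ℝ)` together with the fundamental solution `Φ : Θ₁ × ℝ → SL_d(ℝ)` of the
nonautonomous linear ODE `∂ₜ Φ^t_x = G (φ^t x) Φ^t_x`, `Φ^0_x = Id`. -/
structure ContinuousTimeCocycle {Θ : Type*} [TopologicalSpace Θ] (d : ℕ) (φ : Θ ≃ₜ Θ) where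
  /-- The generator `G`. -/
  generator : C(MappingTorus φ, LieAlgebra.SpecialLinear.sl (Fin d) ℝ)
  /-- The map `(x, t) ↦ Φ^t_x`. -/
  toMap : C(MappingTorus φ × ℝ, SL(d, ℝ))
  /-- `Φ^0_x = Id`. -/
  map_zero : ∀ x, toMap (x, 0) = 1
  /-- The differential equation, for positive and negative time. The derivative of a matrix-valued
  function of `t` is taken entry by entry. -/
  hasDerivAt : ∀ (x : MappingTorus φ) (t : ℝ) (i j : Fin d),
    HasDerivAt (fun s : ℝ => (toMap (x, s) : Matrix (Fin d) (Fin d) ℝ) i j)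
      (((generator (suspensionFlow φ t x) : Matrix (Fin d) (Fin d) ℝ) *
        (toMap (x, t) : Matrix (Fin d) (Fin d) ℝ)) i j) t
  /-- The cocycle property `Φ^{s+t}_x = Φ^t_{φ^s x} Φ^s_x`. -/
  map_add : ∀ (x : MappingTorus φ) (s t : ℝ),
    toMap (x, s + t) = toMap (suspensionFlow φ s x, t) * toMap (x, s)

/-! ### Circle rotations -/

/-- The rotation `θ ↦ θ + α` of the circle `S¹ = ℝ / ℤ` by `α ∈ ℝ`. -/
noncomputable def circleRotation (α : ℝ) : UnitAddCircle ≃ₜ UnitAddCircle :=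
  Homeomorph.addRight (α : UnitAddCircle)

/-!
A loop in `SL(d, ℝ)` that is traversed twice is null-homotopic for `d ≥ 3`, and a sufficiently
smooth null-homotopy of `θ ↦ A (2 θ)` yields a continuous-time cocycle by suspension. The algebraic
form of null-homotopy used here is: being a finite product of families `1 + u(θ) v(θ)ᵀ` of
transvections, where `v(θ)ᵀ u(θ) = 0`. Such products form a normal subgroup `elementaryMaps`, and
scaling every `u` by a smooth transition function `h(t)` from `0` to `1` connects them with the
identity by paths whose logarithmic derivative is continuous and vanishes at both ends
(`nonempty_smoothContraction`). The logarithmic derivative is then a generator on the mapping torus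
with respect to every gluing, and its fundamental solution has the prescribed `n`-step maps
(`SmoothContraction.suspension`).

It remains to show that `θ ↦ A (2 θ)` lies in `elementaryMaps` (`comp_double_mem_elementaryMaps`).
Modulo `elementaryMaps`, a column of `A` supported on at least three indices can be moved to a
constant unit vector, because a loop in a space of dimension at least two can be perturbed off the
origin (`exists_ne_zero_near`). By induction `A` becomes a loop of matrices supported on a
coordinate plane (`exists_mk_eq_supported`), then a loop `R_z` of rotations of that plane, by angles
`z : S¹ → U(1)` (`exists_mk_rotationMap_eq`). A third coordinate provides a constant product of
transvections that conjugates `R_y` to `R_y⁻¹` for every `y`, so `R_y ^ 2` is trivial modulo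
`elementaryMaps` (`rotationMap_mul_self_mem`). Finally, `z (2 θ)` is the square of a continuous map
to `U(1)`, as lifting to the universal cover shows (`exists_mul_self_eq_double`).
-/

open Matrix

/-! ### Continuous families of transvections -/

section Transvections

variable {X Y ι : Type*} [TopologicalSpace X] [TopologicalSpace Y] [Fintype ι] [DecidableEq ι]

theorem det_one_add_vecMulVec (u v : ι → ℝ) : (1 + vecMulVec u v).det = 1 + v ⬝ᵥ u := by
  rw [vecMulVec_eq Unit, det_one_add_replicateCol_mul_replicateRow]

/-- The continuous family `x ↦ 1 + u(x) v(x)ᵀ` of transvections, where `v(x)ᵀ u(x) = 0`. -/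
def transvectionMap (u v : C(X, ι → ℝ)) (h : ∀ x, v x ⬝ᵥ u x = 0) :
    C(X, SpecialLinearGroup ι ℝ) where
  toFun x := ⟨1 + vecMulVec (u x) (v x), by rw [det_one_add_vecMulVec, h, add_zero]⟩
  continuous_toFun := by
    refine Continuous.subtype_mk (continuous_const.add ?_) _
    exact u.continuous.matrix_vecMulVec v.continuous

@[simp]
theorem transvectionMap_apply (u v : C(X, ι → ℝ)) (h : ∀ x, v x ⬝ᵥ u x = 0) (x : X) :
    (transvectionMap u v h x : Matrix ι ι ℝ) = 1 + vecMulVec (u x) (v x) := rfl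

variable (X ι) in
/-- The set of all continuous families of transvections `x ↦ 1 + u(x) v(x)ᵀ`. -/
def transvectionMaps : Set C(X, SpecialLinearGroup ι ℝ) :=
  {g | ∃ (u v : C(X, ι → ℝ)) (h : ∀ x, v x ⬝ᵥ u x = 0), g = transvectionMap u v h}

variable (X ι) in
/-- The group of finite products of continuous families of transvections. -/
def elementaryMaps : Subgroup C(X, SpecialLinearGroup ι ℝ) :=
  Subgroup.closure (transvectionMaps X ι)

theorem transvectionMap_mem (u v : C(X, ι → ℝ)) (h : ∀ x, v x ⬝ᵥ u x = 0) :
    transvectionMap u v h ∈ elementaryMaps X ι :=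
  Subgroup.subset_closure ⟨u, v, h, rfl⟩

theorem inv_mem_transvectionMaps {g : C(X, SpecialLinearGroup ι ℝ)}
    (hg : g ∈ transvectionMaps X ι) : g⁻¹ ∈ transvectionMaps X ι := by
  obtain ⟨u, v, h, rfl⟩ := hg
  refine ⟨-u, v, fun x => by simp [h], inv_eq_of_mul_eq_one_right ?_⟩
  ext1 x
  apply Subtype.ext
  have : vecMulVec (u x) (v x) * vecMulVec (u x) (v x) = 0 := by
    rw [vecMulVec_mul_vecMulVec, h]
    simp
  simp [mul_add, add_mul, this, neg_vecMulVec]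

theorem continuous_coe_matrix (a : C(X, SpecialLinearGroup ι ℝ)) :
    Continuous fun x => (a x : Matrix ι ι ℝ) :=
  continuous_subtype_val.comp a.continuous

theorem Matrix.SpecialLinearGroup.inv_mul_coe (a : SpecialLinearGroup ι ℝ) :
    (↑a⁻¹ : Matrix ι ι ℝ) * (a : Matrix ι ι ℝ) = 1 :=
  congrArg Subtype.val (inv_mul_cancel a)

theorem Matrix.SpecialLinearGroup.mul_inv_coe (a : SpecialLinearGroup ι ℝ) :
    (a : Matrix ι ι ℝ) * (↑a⁻¹ : Matrix ι ι ℝ) = 1 :=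
  congrArg Subtype.val (mul_inv_cancel a)

theorem conj_mem_transvectionMaps {g : C(X, SpecialLinearGroup ι ℝ)}
    (hg : g ∈ transvectionMaps X ι) (a : C(X, SpecialLinearGroup ι ℝ)) :
    a * g * a⁻¹ ∈ transvectionMaps X ι := by
  obtain ⟨u, v, h, rfl⟩ := hg
  refine ⟨⟨fun x => (a x : Matrix ι ι ℝ) *ᵥ u x,
      (continuous_coe_matrix a).matrix_mulVec u.continuous⟩,
    ⟨fun x => v x ᵥ* (↑(a x)⁻¹ : Matrix ι ι ℝ),
      v.continuous.matrix_vecMul (continuous_coe_matrix a⁻¹)⟩, fun x => ?_, ?_⟩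
  · simp only [ContinuousMap.coe_mk]
    rw [dotProduct_mulVec, vecMul_vecMul, SpecialLinearGroup.inv_mul_coe, vecMul_one, h]
  · ext1 x
    apply Subtype.ext
    change (a x : Matrix ι ι ℝ) * (1 + vecMulVec (u x) (v x)) * (↑(a x)⁻¹ : Matrix ι ι ℝ) =
      1 + vecMulVec ((a x : Matrix ι ι ℝ) *ᵥ u x) (v x ᵥ* (↑(a x)⁻¹ : Matrix ι ι ℝ))
    rw [mul_add, add_mul, mul_one, SpecialLinearGroup.mul_inv_coe, mul_vecMulVec, vecMulVec_mul]

/-- Conjugates of transvections are transvections, so they generate a normal subgroup. -/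
instance : (elementaryMaps X ι).Normal where
  conj_mem g hg a := by
    refine Subgroup.closure_induction (p := fun g _ => a * g * a⁻¹ ∈ elementaryMaps X ι)
      (fun g hg => Subgroup.subset_closure (conj_mem_transvectionMaps hg a)) (by simp)
      (fun g g' _ _ h h' => ?_) (fun g _ h => ?_) hg
    · simpa [mul_assoc] using mul_mem h h'
    · simpa [mul_assoc] using inv_mem h

theorem comp_mem_elementaryMaps {g : C(X, SpecialLinearGroup ι ℝ)}
    (hg : g ∈ elementaryMaps X ι) (f : C(Y, X)) : g.comp f ∈ elementaryMaps Y ι := by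
  refine Subgroup.closure_induction (p := fun g _ => g.comp f ∈ elementaryMaps Y ι)
      (fun g hg => ?_) ?_ (fun g g' _ _ h h' => ?_) (fun g _ h => ?_) hg
  · obtain ⟨u, v, h, rfl⟩ := hg
    exact transvectionMap_mem (u.comp f) (v.comp f) fun x => h (f x)
  · rw [ContinuousMap.one_comp]
    exact one_mem _
  · rw [ContinuousMap.mul_comp]
    exact mul_mem h h'
  · rw [ContinuousMap.inv_comp]
    exact inv_mem h

/-- Induction over products of transvections; inverses need no separate case, because the inverse
of a transvection is a transvection. -/
theorem elementaryMaps_induction {p : C(X, SpecialLinearGroup ι ℝ) → Prop}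
    (transvection : ∀ u v h, p (transvectionMap u v h)) (one : p 1)
    (mul : ∀ g g', p g → p g' → p (g * g')) {g : C(X, SpecialLinearGroup ι ℝ)}
    (hg : g ∈ elementaryMaps X ι) : p g := by
  have h : g ∈ Submonoid.closure (transvectionMaps X ι) := by
    have h' : g ∈ (elementaryMaps X ι).toSubmonoid := hg
    rwa [elementaryMaps, Subgroup.closure_toSubmonoid, Set.union_eq_self_of_subset_right] at h'
    intro a ha
    simpa using inv_mem_transvectionMaps (Set.mem_inv.1 ha)
  clear hg
  induction h using Submonoid.closure_induction with
  | mem g hg =>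
    obtain ⟨u, v, h, rfl⟩ := hg
    exact transvection u v h
  | one => exact one
  | mul g g' _ _ ih ih' => exact mul g g' ih ih'

end Transvections

/-! ### Smooth paths from the identity -/

section Paths

theorem hasDerivAt_matrix_mul {ι : Type*} [Fintype ι] {M N : ℝ → Matrix ι ι ℝ}
    {M' N' : Matrix ι ι ℝ} {t : ℝ}
    (hM : ∀ i j, HasDerivAt (fun s => M s i j) (M' i j) t)
    (hN : ∀ i j, HasDerivAt (fun s => N s i j) (N' i j) t) (i j : ι) :
    HasDerivAt (fun s => (M s * N s) i j) ((M' * N t + M t * N') i j) t := by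
  simp only [Matrix.add_apply, Matrix.mul_apply, ← Finset.sum_add_distrib]
  exact HasDerivAt.fun_sum fun k _ => (hM i k).fun_mul (hN k j)

variable {X ι : Type*} [TopologicalSpace X] [Fintype ι] [DecidableEq ι]

theorem continuous_deriv_smoothTransition : Continuous (deriv Real.smoothTransition) :=
  (Real.smoothTransition.contDiff (n := 1)).continuous_deriv le_rfl

theorem deriv_smoothTransition_eq_zero {t : ℝ} (ht : t ≤ 0 ∨ 1 ≤ t) :
    deriv Real.smoothTransition t = 0 := by
  rcases ht with ht | ht
  · refine IsLocalMin.deriv_eq_zero (Filter.Eventually.of_forall fun s => ?_)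
    rw [Real.smoothTransition.zero_of_nonpos ht]
    exact Real.smoothTransition.nonneg s
  · refine IsLocalMax.deriv_eq_zero (Filter.Eventually.of_forall fun s => ?_)
    rw [Real.smoothTransition.one_of_one_le ht]
    exact Real.smoothTransition.le_one s

/-- A family, depending continuously on `x`, of paths in `SL` from `1` to `g x`, with continuous
logarithmic derivative `L` that vanishes outside the time interval `(0, 1)`. The paths are
constant outside `[0, 1]`. The derivative is taken entry by entry. -/
structure SmoothContraction (g : C(X, SpecialLinearGroup ι ℝ)) where
  /-- The path to `g x` at time `t`. -/
  path : C(X × ℝ, SpecialLinearGroup ι ℝ)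
  /-- The logarithmic derivative of the path. -/
  logDeriv : C(X × ℝ, Matrix ι ι ℝ)
  path_of_nonpos : ∀ x t, t ≤ 0 → path (x, t) = 1
  path_of_one_le : ∀ x t, 1 ≤ t → path (x, t) = g x
  logDeriv_eq_zero : ∀ x t, t ≤ 0 ∨ 1 ≤ t → logDeriv (x, t) = 0
  trace_logDeriv : ∀ p, (logDeriv p).trace = 0
  hasDerivAt : ∀ x t i j, HasDerivAt (fun s => (path (x, s) : Matrix ι ι ℝ) i j)
    ((logDeriv (x, t) * (path (x, t) : Matrix ι ι ℝ)) i j) t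

/-- The path `1 + h(t) u vᵀ`, with `h` a smooth transition from `0` to `1`. Since `vᵀ u = 0`, its
logarithmic derivative is `h'(t) u vᵀ`. -/
noncomputable def SmoothContraction.transvection (u v : C(X, ι → ℝ)) (h : ∀ x, v x ⬝ᵥ u x = 0) :
    SmoothContraction (transvectionMap u v h) where
  path := transvectionMap
    ⟨fun p : X × ℝ => Real.smoothTransition p.2 • u p.1, by
      have := Real.smoothTransition.continuous; fun_prop⟩
    (v.comp ⟨Prod.fst, continuous_fst⟩) (fun p => by simp [h])
  logDeriv := ⟨fun p => deriv Real.smoothTransition p.2 • vecMulVec (u p.1) (v p.1),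
    (continuous_deriv_smoothTransition.comp continuous_snd).smul
      ((u.continuous.comp continuous_fst).matrix_vecMulVec (v.continuous.comp continuous_fst))⟩
  path_of_nonpos x t ht := Subtype.ext <| by
    simp [Real.smoothTransition.zero_of_nonpos ht]
  path_of_one_le x t ht := Subtype.ext <| by
    simp [Real.smoothTransition.one_of_one_le ht]
  logDeriv_eq_zero x t ht := by simp [deriv_smoothTransition_eq_zero ht]
  trace_logDeriv p := by
    simp [Matrix.trace_smul, trace_vecMulVec, dotProduct_comm (u p.1), h]
  hasDerivAt x t i j := by
    have hN : vecMulVec (u x) (v x) * vecMulVec (u x) (v x) = 0 := by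
      rw [vecMulVec_mul_vecMulVec, h]
      simp
    have hd : HasDerivAt Real.smoothTransition (deriv Real.smoothTransition t) t :=
      ((Real.smoothTransition.contDiff (n := 1)).differentiable (by simp) t).hasDerivAt
    simp only [transvectionMap_apply, ContinuousMap.coe_mk, ContinuousMap.comp_apply,
      smul_vecMulVec, mul_add, mul_one, smul_mul_assoc, mul_smul_comm, hN, smul_zero, add_zero,
      Matrix.add_apply, Matrix.smul_apply, Matrix.zero_apply, smul_eq_mul]
    exact (hd.mul_const _).const_add _

/-- The constant path. -/
noncomputable def SmoothContraction.one :
    SmoothContraction (1 : C(X, SpecialLinearGroup ι ℝ)) where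
  path := 1
  logDeriv := 0
  path_of_nonpos _ _ _ := rfl
  path_of_one_le _ _ _ := rfl
  logDeriv_eq_zero _ _ _ := rfl
  trace_logDeriv _ := by simp
  hasDerivAt x t i j := by simpa using hasDerivAt_const t _

/-- The pointwise product of two families of paths; the logarithmic derivative of `B B'` is
`L + B L' B⁻¹`. -/
noncomputable def SmoothContraction.mul {g g' : C(X, SpecialLinearGroup ι ℝ)}
    (P : SmoothContraction g) (P' : SmoothContraction g') : SmoothContraction (g * g') where
  path := P.path * P'.path
  logDeriv := ⟨fun p => P.logDeriv p + (P.path p : Matrix ι ι ℝ) * P'.logDeriv p *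
      (↑(P.path p)⁻¹ : Matrix ι ι ℝ),
    P.logDeriv.continuous.add (((continuous_coe_matrix P.path).matrix_mul
      P'.logDeriv.continuous).matrix_mul (continuous_coe_matrix P.path⁻¹))⟩
  path_of_nonpos x t ht := by simp [P.path_of_nonpos x t ht, P'.path_of_nonpos x t ht]
  path_of_one_le x t ht := by simp [P.path_of_one_le x t ht, P'.path_of_one_le x t ht]
  logDeriv_eq_zero x t ht := by
    simp [P.logDeriv_eq_zero x t ht, P'.logDeriv_eq_zero x t ht]
  trace_logDeriv p := by
    change (P.logDeriv p + (P.path p : Matrix ι ι ℝ) * P'.logDeriv p *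
      (↑(P.path p)⁻¹ : Matrix ι ι ℝ)).trace = 0
    rw [Matrix.trace_add, Matrix.trace_mul_cycle, SpecialLinearGroup.inv_mul_coe, one_mul,
      P.trace_logDeriv, P'.trace_logDeriv, add_zero]
  hasDerivAt x t i j := by
    refine (hasDerivAt_matrix_mul (P.hasDerivAt x t) (P'.hasDerivAt x t) i j).congr_deriv
      (Matrix.ext_iff.2 ?_ i j)
    symm
    change (P.logDeriv (x, t) + (P.path (x, t) : Matrix ι ι ℝ) * P'.logDeriv (x, t) *
      (↑(P.path (x, t))⁻¹ : Matrix ι ι ℝ)) *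
        ((P.path (x, t) : Matrix ι ι ℝ) * (P'.path (x, t) : Matrix ι ι ℝ)) = _
    rw [add_mul, Matrix.mul_assoc _ (↑(P.path (x, t))⁻¹ : Matrix ι ι ℝ),
      ← Matrix.mul_assoc (↑(P.path (x, t))⁻¹ : Matrix ι ι ℝ), SpecialLinearGroup.inv_mul_coe,
      one_mul]
    simp only [Matrix.mul_assoc]

theorem nonempty_smoothContraction {g : C(X, SpecialLinearGroup ι ℝ)}
    (hg : g ∈ elementaryMaps X ι) : Nonempty (SmoothContraction g) :=
  elementaryMaps_induction (p := fun g => Nonempty (SmoothContraction g))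
    (fun u v h => ⟨.transvection u v h⟩) ⟨.one⟩ (fun _ _ ⟨P⟩ ⟨P'⟩ => ⟨P.mul P'⟩) hg

end Paths

/-! ### Suspension of a discrete-time cocycle along a path to the identity -/

section Suspension

variable {Θ : Type*} [TopologicalSpace Θ] {d : ℕ} (φ : Θ ≃ₜ Θ) (C : C(Θ, SL(d, ℝ)))

theorem nStep_zero (θ : Θ) : nStep φ C 0 θ = 1 := rfl

theorem nStep_add_one (n : ℤ) (θ : Θ) :
    nStep φ C (n + 1) θ = C ((φ ^ n) θ) * nStep φ C n θ := by
  rcases n with n | n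
  · change nStepForward φ C (n + 1) θ = _
    rw [nStepForward]
    rfl
  · change _ = C ((φ ^ (Int.negSucc n)) θ) *
      ((C ((φ ^ (-((n : ℤ) + 1))) θ))⁻¹ * nStepBackward φ C n θ)
    rw [Int.negSucc_eq, mul_inv_cancel_left]
    rcases n with _ | n
    · rfl
    · have : -((n + 1 : ℕ) + 1 : ℤ) + 1 = Int.negSucc n := by
        rw [Int.negSucc_eq]
        push_cast
        ring
      rw [this]
      rfl

theorem zpow_one_add_apply (n : ℤ) (θ : Θ) : (φ ^ n) (φ θ) = (φ ^ (n + 1)) θ := by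
  rw [_root_.zpow_add_one]
  rfl

theorem nStep_add (m n : ℤ) (θ : Θ) :
    nStep φ C (m + n) θ = nStep φ C m ((φ ^ n) θ) * nStep φ C n θ := by
  induction m generalizing θ with
  | zero => rw [zero_add, nStep_zero, one_mul]
  | succ m ih =>
    rw [add_right_comm, nStep_add_one, ih, nStep_add_one, _root_.zpow_add, mul_assoc]
    rfl
  | pred m ih =>
    have h := nStep_add_one φ C (-(m : ℤ) - 1 + n) θ
    have h' := nStep_add_one φ C (-(m : ℤ) - 1) ((φ ^ n) θ)
    rw [show -(m : ℤ) - 1 + n + 1 = -m + n by ring, ih] at h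
    rw [sub_add_cancel] at h'
    rw [h', mul_assoc, _root_.zpow_add] at h
    exact (mul_left_cancel h).symm

theorem continuous_homeomorph_zpow (n : ℤ) : Continuous fun θ => (φ ^ n) θ := (φ ^ n).continuous

theorem continuous_nStep (n : ℤ) : Continuous (nStep φ C n) := by
  induction n with
  | zero => exact continuous_const
  | succ n ih =>
    have : nStep φ C (n + 1) = fun θ => C ((φ ^ (n : ℤ)) θ) * nStep φ C n θ :=
      funext (nStep_add_one φ C n)
    rw [this]
    exact (C.continuous.comp (φ ^ (n : ℤ)).continuous).mul ih
  | pred n ih =>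
    have : nStep φ C (-(n : ℤ) - 1) =
        fun θ => (C ((φ ^ (-(n : ℤ) - 1)) θ))⁻¹ * nStep φ C (-(n : ℤ)) θ := by
      funext θ
      have h := nStep_add_one φ C (-(n : ℤ) - 1) θ
      rw [sub_add_cancel] at h
      rw [h, inv_mul_cancel_left]
    rw [this]
    exact (C.continuous.comp (φ ^ (-(n : ℤ) - 1)).continuous).inv.mul ih

variable {C} (P : SmoothContraction C)

/-- The fundamental solution started at `(θ, 0)`: at time `n + f`, with `n` an integer and
`0 ≤ f < 1`, the `n`-step map followed by the path at time `f` over `φ^n θ`. -/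
noncomputable def fundamentalSolution (θ : Θ) (t : ℝ) : SL(d, ℝ) :=
  P.path ((φ ^ ⌊t⌋) θ, Int.fract t) * nStep φ C ⌊t⌋ θ

theorem fundamentalSolution_intCast (θ : Θ) (n : ℤ) :
    fundamentalSolution φ P θ n = nStep φ C n θ := by
  simp [fundamentalSolution, P.path_of_nonpos]

theorem fundamentalSolution_zero (θ : Θ) : fundamentalSolution φ P θ 0 = 1 := by
  simpa [nStep_zero] using fundamentalSolution_intCast φ P θ 0

theorem fundamentalSolution_add_intCast (θ : Θ) (t : ℝ) (n : ℤ) :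
    fundamentalSolution φ P θ (t + n) =
      fundamentalSolution φ P ((φ ^ n) θ) t * nStep φ C n θ := by
  rw [fundamentalSolution, fundamentalSolution, Int.floor_add_intCast, Int.fract_add_intCast,
    nStep_add, _root_.zpow_add, mul_assoc]
  rfl

/-- In the time interval `(n - 1, n + 1)` the fundamental solution is a product of two paths, one
of which is constant at each time. This removes the case distinction at the integer `n`. -/
theorem fundamentalSolution_eq (θ : Θ) {n : ℤ} {t : ℝ} (h : (n : ℝ) - 1 < t) (h' : t < n + 1) :
    fundamentalSolution φ P θ t =
      P.path ((φ ^ n) θ, t - n) * P.path ((φ ^ (n - 1)) θ, t - n + 1) * nStep φ C (n - 1) θ := by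
  rcases lt_or_ge t n with ht | ht
  · have hf : ⌊t⌋ = n - 1 := by
      rw [Int.floor_eq_iff]
      push_cast
      constructor <;> linarith
    rw [fundamentalSolution, P.path_of_nonpos _ (t - n) (by linarith), one_mul, Int.fract, hf]
    congr 4
    push_cast
    ring
  · have hf : ⌊t⌋ = n := by
      rw [Int.floor_eq_iff]
      constructor <;> linarith
    rw [fundamentalSolution, P.path_of_one_le _ (t - n + 1) (by linarith), Int.fract, hf, mul_assoc,
      ← nStep_add_one, sub_add_cancel]

theorem exists_int_between (t : ℝ) : ∃ n : ℤ, (n : ℝ) - 1 < t ∧ t < n + 1 :=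
  ⟨⌊t⌋, by linarith [Int.floor_le t], Int.lt_floor_add_one t⟩

theorem continuous_fundamentalSolution :
    Continuous fun p : Θ × ℝ => fundamentalSolution φ P p.1 p.2 := by
  refine continuous_iff_continuousAt.2 fun ⟨θ, t⟩ => ?_
  obtain ⟨n, h, h'⟩ := exists_int_between t
  have hφ := continuous_homeomorph_zpow φ
  have hn := continuous_nStep φ C (n - 1)
  have hc : Continuous fun p : Θ × ℝ => P.path ((φ ^ n) p.1, p.2 - n) *
      P.path ((φ ^ (n - 1)) p.1, p.2 - n + 1) * nStep φ C (n - 1) p.1 := by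
    refine ((P.path.continuous.comp (.prodMk ((hφ n).comp continuous_fst) (by fun_prop))).mul
      (P.path.continuous.comp (.prodMk ((hφ (n - 1)).comp continuous_fst) (by fun_prop)))).mul
      (hn.comp continuous_fst)
  refine hc.continuousAt.congr ?_
  have hmem : ∀ᶠ p : Θ × ℝ in nhds (θ, t), p.2 ∈ Set.Ioo ((n : ℝ) - 1) (n + 1) :=
    continuous_snd.continuousAt.eventually (Ioo_mem_nhds h h')
  filter_upwards [hmem] with p hp
  exact (fundamentalSolution_eq φ P p.1 hp.1 hp.2).symm

theorem logDeriv_fract_eq (θ : Θ) {n : ℤ} {t : ℝ} (h : (n : ℝ) - 1 < t) (h' : t < n + 1) :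
    P.logDeriv ((φ ^ ⌊t⌋) θ, Int.fract t) =
      P.logDeriv ((φ ^ n) θ, t - n) + P.logDeriv ((φ ^ (n - 1)) θ, t - n + 1) := by
  rcases lt_or_ge t n with ht | ht
  · have hf : ⌊t⌋ = n - 1 := by
      rw [Int.floor_eq_iff]
      push_cast
      constructor <;> linarith
    rw [P.logDeriv_eq_zero _ (t - n) (Or.inl (by linarith)), zero_add, Int.fract, hf]
    congr 2
    push_cast
    ring
  · have hf : ⌊t⌋ = n := by
      rw [Int.floor_eq_iff]
      constructor <;> linarith
    rw [P.logDeriv_eq_zero _ (t - n + 1) (Or.inr (by linarith)), add_zero, Int.fract, hf]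

theorem hasDerivAt_fundamentalSolution (θ : Θ) (t : ℝ) (i j : Fin d) :
    HasDerivAt (fun s => (fundamentalSolution φ P θ s : Matrix (Fin d) (Fin d) ℝ) i j)
      ((P.logDeriv ((φ ^ ⌊t⌋) θ, Int.fract t) *
        (fundamentalSolution φ P θ t : Matrix (Fin d) (Fin d) ℝ)) i j) t := by
  obtain ⟨n, h, h'⟩ := exists_int_between t
  rw [logDeriv_fract_eq φ P θ h h', fundamentalSolution_eq φ P θ h h']
  have e₁ (k l : Fin d) := (P.hasDerivAt ((φ ^ n) θ) (t - n) k l).comp_sub_const t n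
  have e₂ (k l : Fin d) := (P.hasDerivAt ((φ ^ (n - 1)) θ) (t - n + 1) k l)
  have e₂' (k l : Fin d) : HasDerivAt _ _ t :=
    ((e₂ k l).comp_add_const (t - n) 1).comp_sub_const t n
  have e₃ (k l : Fin d) : HasDerivAt
      (fun _ : ℝ => (nStep φ C (n - 1) θ : Matrix (Fin d) (Fin d) ℝ) k l)
      ((0 : Matrix (Fin d) (Fin d) ℝ) k l) t := hasDerivAt_const _ _
  have e := hasDerivAt_matrix_mul (hasDerivAt_matrix_mul e₁ e₂') e₃ i j
  refine (e.congr_of_eventuallyEq ?_).congr_deriv (Matrix.ext_iff.2 ?_ i j)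
  · filter_upwards [Ioo_mem_nhds h h'] with s hs
    rw [fundamentalSolution_eq φ P θ hs.1 hs.2]
    rfl
  · rw [Matrix.mul_zero, add_zero]
    change _ = _ * ((P.path ((φ ^ n) θ, t - n) : Matrix (Fin d) (Fin d) ℝ) *
      (P.path ((φ ^ (n - 1)) θ, t - n + 1) : Matrix (Fin d) (Fin d) ℝ) *
      (nStep φ C (n - 1) θ : Matrix (Fin d) (Fin d) ℝ))
    -- Either the first path is still at `1`, or the second one no longer moves.
    rcases le_total t n with ht | ht
    · rw [P.path_of_nonpos _ (t - n) (by linarith),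
        P.logDeriv_eq_zero _ (t - n) (Or.inl (by linarith))]
      simp [Matrix.mul_assoc]
    · rw [P.logDeriv_eq_zero _ (t - n + 1) (Or.inr (by linarith))]
      simp [Matrix.mul_assoc]

/-- The generator of the suspended cocycle: the logarithmic derivative of the path, which vanishes
at both ends of the gluing. -/
noncomputable def suspensionGenerator :
    C(MappingTorus φ, LieAlgebra.SpecialLinear.sl (Fin d) ℝ) where
  toFun := Quot.lift
    (fun p => ⟨P.logDeriv (p.1, (p.2 : ℝ)), by
      change (P.logDeriv (p.1, (p.2 : ℝ))).trace = 0
      exact P.trace_logDeriv _⟩)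
    (by
      rintro _ _ ⟨θ⟩
      refine Subtype.ext ?_
      change P.logDeriv (θ, ((1 : unitInterval) : ℝ)) =
        P.logDeriv (φ θ, ((0 : unitInterval) : ℝ))
      rw [P.logDeriv_eq_zero _ _ (Or.inr (by simp)), P.logDeriv_eq_zero _ _ (Or.inl (by simp))])
  continuous_toFun := by
    refine continuous_quot_lift _ (Continuous.subtype_mk ?_ _)
    exact P.logDeriv.continuous.comp (by fun_prop)

/-- The solution operator from time `r` to time `r + t` over the orbit through `(θ, 0)`. -/
noncomputable def suspensionMap (p : Θ × unitInterval) (t : ℝ) : SL(d, ℝ) :=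
  fundamentalSolution φ P p.1 (p.2 + t) * (fundamentalSolution φ P p.1 p.2)⁻¹

theorem suspensionMap_glue (θ : Θ) (t : ℝ) :
    suspensionMap φ P (θ, 1) t = suspensionMap φ P (φ θ, 0) t := by
  have h1 (s : ℝ) : fundamentalSolution φ P θ (s + 1) = fundamentalSolution φ P (φ θ) s * C θ := by
    have h := fundamentalSolution_add_intCast φ P θ s 1
    have hC : nStep φ C 1 θ = C θ := by
      have := nStep_add_one φ C 0 θ
      rwa [nStep_zero, mul_one] at this
    rwa [hC, Int.cast_one, zpow_one] at h
  have h2 := h1 0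
  rw [zero_add, fundamentalSolution_zero, one_mul] at h2
  simp only [suspensionMap, Set.Icc.coe_one, Set.Icc.coe_zero]
  rw [add_comm, h1, h2, fundamentalSolution_zero, mul_inv_cancel_right, zero_add, inv_one, mul_one]

theorem continuous_suspensionMap :
    Continuous fun q : (Θ × unitInterval) × ℝ => suspensionMap φ P q.1 q.2 := by
  have h := continuous_fundamentalSolution φ P
  exact (h.comp (g := fun p : Θ × ℝ => _) (f := fun q : (Θ × unitInterval) × ℝ =>
    (q.1.1, (q.1.2 : ℝ) + q.2)) (by fun_prop)).mul
    (h.comp (g := fun p : Θ × ℝ => _) (f := fun q : (Θ × unitInterval) × ℝ =>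
    (q.1.1, (q.1.2 : ℝ))) (by fun_prop)).inv

/-- The continuous-time cocycle over the suspension flow whose generator is the logarithmic
derivative of the given paths from `1` to `C`. -/
noncomputable def SmoothContraction.suspension : ContinuousTimeCocycle d φ where
  generator := suspensionGenerator φ P
  toMap :=
    { toFun := fun q => Quot.lift (suspensionMap φ P)
        (by
          rintro _ _ ⟨θ⟩
          exact funext (suspensionMap_glue φ P θ)) q.1 q.2
      continuous_toFun :=
        Topology.IsQuotientMap.continuous_lift_prod_left (f := Quot.mk (MappingTorusRel φ))
          isQuotientMap_quot_mk (continuous_suspensionMap φ P) }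
  map_zero := by
    rintro ⟨θ, r⟩
    change suspensionMap φ P (θ, r) 0 = 1
    simp [suspensionMap]
  hasDerivAt := by
    rintro ⟨θ, r⟩ t i j
    have h (k l : Fin d) :=
      (hasDerivAt_fundamentalSolution φ P θ (r + t) k l).comp_const_add (r : ℝ) t
    have e (k l : Fin d) : HasDerivAt
      (fun _ : ℝ => (↑(fundamentalSolution φ P θ r)⁻¹ : Matrix (Fin d) (Fin d) ℝ) k l)
      ((0 : Matrix (Fin d) (Fin d) ℝ) k l) t := hasDerivAt_const _ _
    refine (hasDerivAt_matrix_mul h e i j).congr_deriv (Matrix.ext_iff.2 ?_ i j)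
    rw [Matrix.mul_zero, add_zero, Matrix.mul_assoc]
    rfl
  map_add := by
    rintro ⟨θ, r⟩ s t
    change suspensionMap φ P (θ, r) (s + t) =
      suspensionMap φ P ((φ ^ ⌊(r : ℝ) + s⌋) θ, ⟨Int.fract ((r : ℝ) + s), _⟩) t *
        suspensionMap φ P (θ, r) s
    have h1 := fundamentalSolution_add_intCast φ P θ (Int.fract ((r : ℝ) + s)) ⌊(r : ℝ) + s⌋
    have h2 := fundamentalSolution_add_intCast φ P θ (Int.fract ((r : ℝ) + s) + t) ⌊(r : ℝ) + s⌋
    rw [Int.fract_add_floor] at h1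
    rw [add_right_comm, Int.fract_add_floor] at h2
    simp only [suspensionMap]
    rw [← add_assoc, h1, h2]
    group

theorem SmoothContraction.suspension_toMap_intCast (θ : Θ) (n : ℤ) :
    (P.suspension φ).toMap (MappingTorus.mk φ θ 0, (n : ℝ)) = nStep φ C n θ := by
  change suspensionMap φ P (θ, 0) n = _
  simp [suspensionMap, fundamentalSolution_zero, fundamentalSolution_intCast]

end Suspension

/-! ### Matrices supported on a set of indices -/

section Supported

variable {X ι : Type*} [TopologicalSpace X] [Fintype ι] [DecidableEq ι]

theorem one_add_vecMulVec_mulVec (u v w : ι → ℝ) :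
    (1 + vecMulVec u v) *ᵥ w = w + (v ⬝ᵥ w) • u := by
  rw [add_mulVec, one_mulVec, vecMulVec_mulVec, op_smul_eq_smul]

theorem vecMul_one_add_vecMulVec (u v w : ι → ℝ) :
    w ᵥ* (1 + vecMulVec u v) = w + (w ⬝ᵥ u) • v := by
  rw [vecMul_add, vecMul_one, vecMul_vecMulVec]

/-- The group of matrices in `SL` that coincide with the identity in all rows and columns with
index outside `S`. -/
def supportedSubgroup (S : Finset ι) : Subgroup (SpecialLinearGroup ι ℝ) where
  carrier := {A | ∀ i ∉ S, (A : Matrix ι ι ℝ) *ᵥ Pi.single i 1 = Pi.single i 1 ∧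
    Pi.single i 1 ᵥ* (A : Matrix ι ι ℝ) = Pi.single i 1}
  one_mem' i _ := ⟨one_mulVec _, vecMul_one _⟩
  mul_mem' {A B} hA hB i hi := by
    change ((A : Matrix ι ι ℝ) * (B : Matrix ι ι ℝ)) *ᵥ _ = _ ∧
      _ ᵥ* ((A : Matrix ι ι ℝ) * (B : Matrix ι ι ℝ)) = _
    rw [← mulVec_mulVec, (hB i hi).1, (hA i hi).1, ← vecMul_vecMul,
      (hA i hi).2, (hB i hi).2]
    exact ⟨rfl, rfl⟩
  inv_mem' {A} hA i hi := by
    constructor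
    · conv_lhs => rw [← (hA i hi).1, mulVec_mulVec, SpecialLinearGroup.inv_mul_coe, one_mulVec]
    · conv_lhs => rw [← (hA i hi).2, vecMul_vecMul, SpecialLinearGroup.mul_inv_coe, vecMul_one]

theorem apply_eq_zero_of_mem_supportedSubgroup {S : Finset ι} {A : SpecialLinearGroup ι ℝ}
    (hA : A ∈ supportedSubgroup S) {i k : ι} (hi : i ∉ S) (hk : k ∈ S) :
    (A : Matrix ι ι ℝ) i k = 0 ∧ (A : Matrix ι ι ℝ) k i = 0 := by
  have hki : k ≠ i := fun h => hi (h ▸ hk)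
  obtain ⟨h1, h2⟩ := hA i hi
  rw [mulVec_single_one] at h1
  rw [single_one_vecMul] at h2
  constructor
  · have := congrFun h2 k
    rwa [Pi.single_eq_of_ne hki] at this
  · have := congrFun h1 k
    rwa [Pi.single_eq_of_ne hki] at this

theorem mem_supportedSubgroup_erase {S : Finset ι} {A : SpecialLinearGroup ι ℝ}
    (hA : A ∈ supportedSubgroup S) {k : ι}
    (h : (A : Matrix ι ι ℝ) *ᵥ Pi.single k 1 = Pi.single k 1)
    (h' : Pi.single k 1 ᵥ* (A : Matrix ι ι ℝ) = Pi.single k 1) :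
    A ∈ supportedSubgroup (S.erase k) := fun i hi => by
  by_cases hik : i = k
  · subst hik
    exact ⟨h, h'⟩
  · exact hA i fun hiS => hi (Finset.mem_erase.2 ⟨hik, hiS⟩)

theorem supportedSubgroup_singleton {A : SpecialLinearGroup ι ℝ} {k : ι}
    (hA : A ∈ supportedSubgroup {k}) : A = 1 := by
  have hd : (A : Matrix ι ι ℝ) =
      diagonal fun i => if i = k then (A : Matrix ι ι ℝ) k k else 1 := by
    ext i j
    by_cases hj : j = k
    · subst hj
      by_cases hi : i = j
      · subst hi
        simp
      · rw [diagonal_apply_ne _ hi]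
        exact (apply_eq_zero_of_mem_supportedSubgroup hA (by simpa using hi) (by simp)).1
    · have := congrFun (hA j (by simpa using hj)).1 i
      rw [mulVec_single_one] at this
      refine this.trans ?_
      by_cases hi : i = j
      · subst hi
        simp [hj]
      · rw [diagonal_apply_ne _ hi, Pi.single_eq_of_ne hi]
  have h1 : (A : Matrix ι ι ℝ) k k = 1 := by
    have := A.det_coe
    rw [hd, det_diagonal] at this
    simpa using this
  apply Subtype.ext
  refine hd.trans ?_
  simp [h1]

theorem transvectionMap_mem_supportedSubgroup {S : Finset ι} (u v : C(X, ι → ℝ))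
    (h : ∀ x, v x ⬝ᵥ u x = 0) (hu : ∀ x, ∀ i ∉ S, u x i = 0) (hv : ∀ x, ∀ i ∉ S, v x i = 0)
    (x : X) : transvectionMap u v h x ∈ supportedSubgroup S := fun i hi => by
  rw [transvectionMap_apply, one_add_vecMulVec_mulVec, vecMul_one_add_vecMulVec,
    dotProduct_single_one, single_one_dotProduct, hu x i hi, hv x i hi]
  simp

/-- If a family of functionals `f` takes the value `1` on both `v` and `v'`, then the transvection
`1 + (v' - v) fᵀ` maps `v` to `v'`. -/
theorem exists_transvection_mulVec_eq {S : Finset ι} (v v' f : C(X, ι → ℝ))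
    (hv : ∀ x, f x ⬝ᵥ v x = 1) (hv' : ∀ x, f x ⬝ᵥ v' x = 1) (hvS : ∀ x, ∀ i ∉ S, v x i = 0)
    (hvS' : ∀ x, ∀ i ∉ S, v' x i = 0) (hfS : ∀ x, ∀ i ∉ S, f x i = 0) :
    ∃ T ∈ elementaryMaps X ι, (∀ x, T x ∈ supportedSubgroup S) ∧
      ∀ x, (T x : Matrix ι ι ℝ) *ᵥ v x = v' x := by
  have h : ∀ x, f x ⬝ᵥ (v' - v) x = 0 := fun x => by
    simp [dotProduct_sub, hv, hv']
  refine ⟨_, transvectionMap_mem (v' - v) f h, transvectionMap_mem_supportedSubgroup _ _ _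
    (fun x i hi => by simp [hvS x i hi, hvS' x i hi]) hfS, fun x => ?_⟩
  rw [transvectionMap_apply, one_add_vecMulVec_mulVec, hv]
  simp

/-- If column `k` of `M` is the `k`-th unit vector, then a single transvection turns row `k` into a
unit vector as well. -/
theorem exists_mk_eq_supported_erase_of_column {S : Finset ι} {k : ι} (hk : k ∈ S)
    {M : C(X, SpecialLinearGroup ι ℝ)} (hM : ∀ x, M x ∈ supportedSubgroup S)
    (hcol : ∀ x, (M x : Matrix ι ι ℝ) *ᵥ Pi.single k 1 = Pi.single k 1) :
    ∃ N : C(X, SpecialLinearGroup ι ℝ), (∀ x, N x ∈ supportedSubgroup (S.erase k)) ∧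
      (QuotientGroup.mk N : C(X, SpecialLinearGroup ι ℝ) ⧸ elementaryMaps X ι) =
        QuotientGroup.mk M := by
  let u : C(X, ι → ℝ) := ContinuousMap.const X (Pi.single k 1)
  let v : C(X, ι → ℝ) := ⟨fun x => Pi.single k 1 ᵥ* (M x : Matrix ι ι ℝ) - Pi.single k 1,
    (continuous_const.matrix_vecMul (continuous_coe_matrix M)).sub continuous_const⟩
  have h : ∀ x, v x ⬝ᵥ u x = 0 := fun x => by
    change (Pi.single k 1 ᵥ* (M x : Matrix ι ι ℝ) - Pi.single k 1) ⬝ᵥ Pi.single k 1 = 0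
    rw [sub_dotProduct, ← dotProduct_mulVec, hcol, sub_self]
  let T := transvectionMap u v h
  have hT : T ∈ elementaryMaps X ι := transvectionMap_mem u v h
  have hTS : ∀ x, T x ∈ supportedSubgroup S :=
    transvectionMap_mem_supportedSubgroup u v h
      (fun x i hi => Pi.single_eq_of_ne (fun h : i = k => hi (h ▸ hk)) _)
      (fun x i hi => by
        have hik : i ≠ k := fun h => hi (h ▸ hk)
        change (Pi.single k 1 ᵥ* (M x : Matrix ι ι ℝ)) i - (Pi.single k 1 : ι → ℝ) i = 0
        rw [single_one_vecMul, Pi.single_eq_of_ne hik, sub_zero]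
        exact (apply_eq_zero_of_mem_supportedSubgroup (hM x) hi hk).2)
  have hTcol : ∀ x, (T x : Matrix ι ι ℝ) *ᵥ Pi.single k 1 = Pi.single k 1 := fun x => by
    have hvu : v x ⬝ᵥ Pi.single k 1 = 0 := h x
    rw [transvectionMap_apply, one_add_vecMulVec_mulVec, hvu, zero_smul, add_zero]
  have hTrow : ∀ x, Pi.single k 1 ᵥ* (T x : Matrix ι ι ℝ) =
      Pi.single k 1 ᵥ* (M x : Matrix ι ι ℝ) := fun x => by
    rw [transvectionMap_apply, vecMul_one_add_vecMulVec]
    change _ + (Pi.single k 1 ⬝ᵥ Pi.single k 1 : ℝ) •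
      (Pi.single k 1 ᵥ* (M x : Matrix ι ι ℝ) - Pi.single k 1) = _
    simp
  refine ⟨M * T⁻¹, fun x => mem_supportedSubgroup_erase
    (mul_mem (hM x) (inv_mem (hTS x))) ?_ ?_, ?_⟩
  · change ((M x : Matrix ι ι ℝ) * (↑(T x)⁻¹ : Matrix ι ι ℝ)) *ᵥ _ = _
    conv_lhs => rw [← hTcol x]
    rw [← mulVec_mulVec, mulVec_mulVec _ (↑(T x)⁻¹ : Matrix ι ι ℝ),
      SpecialLinearGroup.inv_mul_coe, one_mulVec, hcol]
  · change _ ᵥ* ((M x : Matrix ι ι ℝ) * (↑(T x)⁻¹ : Matrix ι ι ℝ)) = _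
    rw [← vecMul_vecMul, ← hTrow, vecMul_vecMul, SpecialLinearGroup.mul_inv_coe, vecMul_one]
  · rw [QuotientGroup.mk_mul, QuotientGroup.mk_inv, (QuotientGroup.eq_one_iff T).2 hT, inv_one,
      mul_one]

end Supported

/-! ### Reduction to a plane over the circle -/

section Reduction

/-- Stone–Weierstrass for the subalgebra of `C¹` functions on the circle, which separates points
because it contains sine and cosine. -/
theorem exists_contDiff_near (f : C(UnitAddCircle, ℝ)) {ε : ℝ} (hε : 0 < ε) :
    ∃ g : C(UnitAddCircle, ℝ), ContDiff ℝ 1 (fun t : ℝ => g t) ∧ ∀ x, |g x - f x| < ε := by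
  let A : Subalgebra ℝ C(UnitAddCircle, ℝ) :=
    { carrier := {g | ContDiff ℝ 1 (fun t : ℝ => g t)}
      mul_mem' := fun {f g} hf hg => by
        have hf' : ContDiff ℝ 1 (fun t : ℝ => f t) := hf
        exact hf'.mul hg
      add_mem' := fun {f g} hf hg => by
        have hf' : ContDiff ℝ 1 (fun t : ℝ => f t) := hf
        exact hf'.add hg
      algebraMap_mem' := fun r => by
        have h : ContDiff ℝ 1 (fun _ : ℝ => r) := contDiff_const
        exact h }
  have hA : A.SeparatesPoints := by
    intro x y hxy
    have hre : Continuous fun x : UnitAddCircle => (AddCircle.toCircle x : ℂ).re :=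
      Complex.continuous_re.comp (continuous_subtype_val.comp AddCircle.continuous_toCircle)
    have him : Continuous fun x : UnitAddCircle => (AddCircle.toCircle x : ℂ).im :=
      Complex.continuous_im.comp (continuous_subtype_val.comp AddCircle.continuous_toCircle)
    have hne : AddCircle.toCircle x ≠ AddCircle.toCircle y := fun h =>
      hxy (AddCircle.injective_toCircle one_ne_zero h)
    by_cases hr : (AddCircle.toCircle x : ℂ).re = (AddCircle.toCircle y : ℂ).re
    · refine ⟨_, ⟨⟨_, him⟩, ?_, rfl⟩, fun h => hne (Circle.ext (Complex.ext hr h))⟩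
      change ContDiff ℝ 1 fun t : ℝ => (AddCircle.toCircle (t : UnitAddCircle) : ℂ).im
      simp only [AddCircle.toCircle_apply_mk, Circle.coe_exp, Complex.exp_ofReal_mul_I_im]
      fun_prop
    · refine ⟨_, ⟨⟨_, hre⟩, ?_, rfl⟩, hr⟩
      change ContDiff ℝ 1 fun t : ℝ => (AddCircle.toCircle (t : UnitAddCircle) : ℂ).re
      simp only [AddCircle.toCircle_apply_mk, Circle.coe_exp, Complex.exp_ofReal_mul_I_re]
      fun_prop
  obtain ⟨⟨g, hg⟩, h⟩ :=
    ContinuousMap.exists_mem_subalgebra_near_continuous_of_separatesPoints A hA f f.continuous ε hε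
  exact ⟨g, hg, h⟩

/-- A loop in a real vector space of dimension at least two can be moved off the origin by an
arbitrarily small perturbation: approximate it by a `C¹` loop, whose image has dense complement,
and subtract a small vector outside that image. -/
theorem exists_ne_zero_near {κ : Type*} [Fintype κ] (hκ : 2 ≤ Fintype.card κ)
    (f : C(UnitAddCircle, κ → ℝ)) {ε : ℝ} (hε : 0 < ε) :
    ∃ g : C(UnitAddCircle, κ → ℝ), (∀ x, g x ≠ 0) ∧ ∀ x i, |g x i - f x i| < ε := by
  choose p hp hpf using fun i : κ =>
    exists_contDiff_near ⟨fun x => f x i, (continuous_apply i).comp f.continuous⟩ (half_pos hε)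
  have hF : ContDiff ℝ 1 fun (t : ℝ) (i : κ) => p i t := contDiff_pi.2 hp
  have hd := hF.dense_compl_range_of_finrank_lt_finrank (by
    rw [Module.finrank_self, Module.finrank_fintype_fun_eq_card]
    omega)
  obtain ⟨c, hc, hcε⟩ := Metric.dense_iff.1 hd 0 (ε / 2) (half_pos hε)
  rw [Metric.mem_ball, dist_zero_right] at hc
  refine ⟨⟨fun x i => p i x - c i, by fun_prop⟩, fun x hx => ?_, fun x i => ?_⟩
  · induction x using QuotientAddGroup.induction_on with
    | H t => exact hcε ⟨t, funext fun i => sub_eq_zero.1 (congrFun hx i)⟩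
  · have h1 : |p i x - f x i| < ε / 2 := hpf i x
    have h2 : |c i| < ε / 2 := (norm_le_pi_norm c i).trans_lt hc
    change |p i x - c i - f x i| < ε
    rw [abs_lt] at *
    constructor <;> linarith

variable {ι : Type*} [Fintype ι] [DecidableEq ι]

/-- A family of unimodular vectors over the circle, supported on at least three indices, can be
transformed into the constant unit vector `e_k`. First move `v` to a vector whose projection along
`e_k` vanishes nowhere, then connect the latter with `e_k` by a functional that takes the value `1`
on both. -/
theorem exists_mulVec_eq_single {S : Finset ι} (hS : 3 ≤ S.card) {k : ι} (hk : k ∈ S)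
    (v f : C(UnitAddCircle, ι → ℝ)) (hfv : ∀ x, f x ⬝ᵥ v x = 1)
    (hvS : ∀ x, ∀ i ∉ S, v x i = 0) (hfS : ∀ x, ∀ i ∉ S, f x i = 0) :
    ∃ T ∈ elementaryMaps UnitAddCircle ι, (∀ x, T x ∈ supportedSubgroup S) ∧
      ∀ x, (T x : Matrix ι ι ℝ) *ᵥ v x = Pi.single k 1 := by
  have hv (i : ι) : Continuous fun x => v x i := (continuous_apply i).comp v.continuous
  have hf (i : ι) : Continuous fun x => f x i := (continuous_apply i).comp f.continuous
  obtain ⟨K, hK⟩ := (isCompact_range (f := fun x => ∑ i, |f x i|)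
    (continuous_finsetSum _ fun i _ => (hf i).abs)).bddAbove
  have hK' (x : UnitAddCircle) : ∑ i, |f x i| ≤ K := hK ⟨x, rfl⟩
  have hK0 : 0 ≤ K := (Finset.sum_nonneg fun i _ => abs_nonneg (f 0 i)).trans (hK' 0)
  obtain ⟨g, hg0, hg⟩ := exists_ne_zero_near (κ := S.erase k)
    (by rw [Fintype.card_coe, Finset.card_erase_of_mem hk]; omega)
    ⟨fun x i => v x i, continuous_pi fun i => hv i⟩ (ε := 1 / (K + 1)) (by positivity)
  -- `w` is so close to `v` that `f` stays positive on it; the `k`-th coordinate is kept.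
  let w : C(UnitAddCircle, ι → ℝ) :=
    ⟨fun x i => if h : i ∈ S.erase k then g x ⟨i, h⟩ else v x i, continuous_pi fun i => by
      by_cases h : i ∈ S.erase k
      · simp only [h, dite_true]
        exact (continuous_apply _).comp g.continuous
      · simpa only [h, dite_false] using hv i⟩
  have hwv (x : UnitAddCircle) (i : ι) : |w x i - v x i| ≤ 1 / (K + 1) := by
    by_cases h : i ∈ S.erase k
    · simpa only [w, ContinuousMap.coe_mk, h, dite_true] using (hg x ⟨i, h⟩).le
    · simp only [w, ContinuousMap.coe_mk, h, dite_false, sub_self, abs_zero]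
      positivity
  have hwS : ∀ x, ∀ i ∉ S, w x i = 0 := fun x i hi => by
    have h : i ∉ S.erase k := fun h => hi (Finset.mem_of_mem_erase h)
    simpa only [w, ContinuousMap.coe_mk, h, dite_false] using hvS x i hi
  have hfw (x : UnitAddCircle) : 0 < f x ⬝ᵥ w x := by
    have h1 : |f x ⬝ᵥ (w x - v x)| < 1 := by
      calc |f x ⬝ᵥ (w x - v x)| ≤ ∑ i, |f x i * (w x - v x) i| := Finset.abs_sum_le_sum_abs _ _
        _ ≤ ∑ i, |f x i| * (1 / (K + 1)) := Finset.sum_le_sum fun i _ => by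
          rw [abs_mul]
          exact mul_le_mul_of_nonneg_left (hwv x i) (abs_nonneg _)
        _ = (∑ i, |f x i|) * (1 / (K + 1)) := (Finset.sum_mul ..).symm
        _ ≤ K * (1 / (K + 1)) := mul_le_mul_of_nonneg_right (hK' x) (by positivity)
        _ < 1 := by
          rw [mul_one_div, div_lt_one (by positivity)]
          linarith
    rw [dotProduct_sub, hfv] at h1
    linarith [(abs_lt.1 h1).1]
  have hfwc : Continuous fun x => (f x ⬝ᵥ w x)⁻¹ :=
    (f.continuous.dotProduct w.continuous).inv₀ fun x => (hfw x).ne'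
  let v' : C(UnitAddCircle, ι → ℝ) := ⟨fun x => (f x ⬝ᵥ w x)⁻¹ • w x, hfwc.smul w.continuous⟩
  have hfv' (x : UnitAddCircle) : f x ⬝ᵥ v' x = 1 := by
    change f x ⬝ᵥ ((f x ⬝ᵥ w x)⁻¹ • w x) = 1
    rw [dotProduct_smul, smul_eq_mul, inv_mul_cancel₀ (hfw x).ne']
  have hv'S : ∀ x, ∀ i ∉ S, v' x i = 0 := fun x i hi => by
    change (f x ⬝ᵥ w x)⁻¹ * w x i = 0
    rw [hwS x i hi, mul_zero]
  have hv'c (i : ι) : Continuous fun x => v' x i := (continuous_apply i).comp v'.continuous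
  obtain ⟨T₁, hT₁, hT₁S, hT₁v⟩ := exists_transvection_mulVec_eq v v' f hfv hfv' hvS hv'S hfS
  have hn (x : UnitAddCircle) : 0 < ∑ i ∈ S.erase k, v' x i ^ 2 := by
    obtain ⟨⟨i, hi⟩, hgi⟩ := Function.ne_iff.1 (hg0 x)
    refine Finset.sum_pos' (fun i _ => sq_nonneg _) ⟨i, hi, ?_⟩
    have : v' x i ≠ 0 := by
      change (f x ⬝ᵥ w x)⁻¹ * w x i ≠ 0
      refine mul_ne_zero (inv_ne_zero (hfw x).ne') ?_
      simpa only [w, ContinuousMap.coe_mk, hi, dite_true, Pi.zero_apply] using hgi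
    positivity
  -- The functional with `f'_k = 1` and `f'` proportional to `v'` on the other coordinates, so
  -- scaled that `f'ᵀ v' = 1`.
  let f' : C(UnitAddCircle, ι → ℝ) := ⟨fun x i => if i = k then 1 else if i ∈ S then
    (1 - v' x k) / (∑ i ∈ S.erase k, v' x i ^ 2) * v' x i else 0, continuous_pi fun i => by
      have hc : Continuous fun x => (1 - v' x k) / (∑ i ∈ S.erase k, v' x i ^ 2) * v' x i :=
        ((continuous_const.sub (hv'c k)).div
          (continuous_finsetSum _ fun i _ => (hv'c i).pow 2) fun x => (hn x).ne').mul (hv'c i)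
      split_ifs
      · exact continuous_const
      · exact hc
      · exact continuous_const⟩
  have hf'k (x : UnitAddCircle) : f' x k = 1 := by
    simp only [f', ContinuousMap.coe_mk, if_true]
  have hf'v' (x : UnitAddCircle) : f' x ⬝ᵥ v' x = 1 := by
    have h0 : ∀ i ∉ S, f' x i * v' x i = 0 := fun i hi => by rw [hv'S x i hi, mul_zero]
    rw [dotProduct, ← Finset.sum_subset (Finset.subset_univ S) fun i _ hi => h0 i hi,
      ← Finset.add_sum_erase S _ hk, hf'k]
    have h1 : ∀ i ∈ S.erase k, f' x i * v' x i =
        (1 - v' x k) / (∑ i ∈ S.erase k, v' x i ^ 2) * v' x i ^ 2 := fun i hi => by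
      have hik := Finset.ne_of_mem_erase hi
      have hiS := Finset.mem_of_mem_erase hi
      simp only [f', ContinuousMap.coe_mk, hik, hiS, if_true, if_false]
      ring
    rw [Finset.sum_congr rfl h1, ← Finset.mul_sum, div_mul_cancel₀ _ (hn x).ne']
    ring
  have hf'S : ∀ x, ∀ i ∉ S, f' x i = 0 := fun x i hi => by
    have hik : i ≠ k := fun h => hi (h ▸ hk)
    simp only [f', ContinuousMap.coe_mk, hik, hi, if_false]
  obtain ⟨T₂, hT₂, hT₂S, hT₂v⟩ := exists_transvection_mulVec_eq v'
    (ContinuousMap.const _ (Pi.single k 1)) f' hf'v' (fun x => by simp [hf'k]) hv'S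
    (fun x i hi => Pi.single_eq_of_ne (fun h : i = k => hi (h ▸ hk)) _) hf'S
  refine ⟨T₂ * T₁, mul_mem hT₂ hT₁, fun x => mul_mem (hT₂S x) (hT₁S x), fun x => ?_⟩
  change ((T₂ x : Matrix ι ι ℝ) * (T₁ x : Matrix ι ι ℝ)) *ᵥ v x = _
  rw [← mulVec_mulVec, hT₁v, hT₂v]
  rfl

/-- Modulo the elementary maps, an index can be removed from the support of a loop of matrices as
long as the support has at least three elements. -/
theorem exists_mk_eq_supported_erase {S : Finset ι} (hS : 3 ≤ S.card) {k : ι} (hk : k ∈ S)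
    {M : C(UnitAddCircle, SpecialLinearGroup ι ℝ)} (hM : ∀ x, M x ∈ supportedSubgroup S) :
    ∃ N : C(UnitAddCircle, SpecialLinearGroup ι ℝ), (∀ x, N x ∈ supportedSubgroup (S.erase k)) ∧
      (QuotientGroup.mk N :
        C(UnitAddCircle, SpecialLinearGroup ι ℝ) ⧸ elementaryMaps UnitAddCircle ι) =
        QuotientGroup.mk M := by
  obtain ⟨T, hT, hTS, hTv⟩ := exists_mulVec_eq_single hS hk
    ⟨fun x => (M x : Matrix ι ι ℝ) *ᵥ Pi.single k 1,
      (continuous_coe_matrix M).matrix_mulVec continuous_const⟩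
    ⟨fun x => Pi.single k 1 ᵥ* (↑(M x)⁻¹ : Matrix ι ι ℝ),
      continuous_const.matrix_vecMul (continuous_coe_matrix M⁻¹)⟩
    (fun x => by
      simp only [ContinuousMap.coe_mk]
      rw [← dotProduct_mulVec, mulVec_mulVec, SpecialLinearGroup.inv_mul_coe, one_mulVec]
      simp)
    (fun x i hi => by
      simp only [ContinuousMap.coe_mk]
      rw [mulVec_single_one]
      exact (apply_eq_zero_of_mem_supportedSubgroup (hM x) hi hk).1)
    (fun x i hi => by
      simp only [ContinuousMap.coe_mk]
      rw [single_one_vecMul]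
      exact (apply_eq_zero_of_mem_supportedSubgroup (inv_mem (hM x)) hi hk).2)
  obtain ⟨N, hN, hNM⟩ := exists_mk_eq_supported_erase_of_column (M := T * M) hk
    (fun x => mul_mem (hTS x) (hM x)) (fun x => by
      change ((T x : Matrix ι ι ℝ) * (M x : Matrix ι ι ℝ)) *ᵥ _ = _
      rw [← mulVec_mulVec]
      exact hTv x)
  refine ⟨N, hN, hNM.trans ?_⟩
  rw [QuotientGroup.mk_mul, (QuotientGroup.eq_one_iff T).2 hT, one_mul]

theorem exists_mk_eq_supported {S T : Finset ι} (hTS : T ⊆ S) (hT : T.card = 2)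
    {M : C(UnitAddCircle, SpecialLinearGroup ι ℝ)} (hM : ∀ x, M x ∈ supportedSubgroup S) :
    ∃ N : C(UnitAddCircle, SpecialLinearGroup ι ℝ), (∀ x, N x ∈ supportedSubgroup T) ∧
      (QuotientGroup.mk N :
        C(UnitAddCircle, SpecialLinearGroup ι ℝ) ⧸ elementaryMaps UnitAddCircle ι) =
        QuotientGroup.mk M := by
  induction h : S.card generalizing S M with
  | zero => exact absurd (Finset.card_le_card hTS) (by omega)
  | succ n ih =>
    by_cases hST : S = T
    · exact ⟨M, hST ▸ hM, rfl⟩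
    · have hlt := Finset.card_lt_card (hTS.ssubset_of_ne (Ne.symm hST))
      obtain ⟨k, hkS, hkT⟩ := Finset.exists_of_ssubset (hTS.ssubset_of_ne (Ne.symm hST))
      obtain ⟨N, hN, hNM⟩ := exists_mk_eq_supported_erase (by omega) hkS hM
      obtain ⟨N', hN', hN'N⟩ := ih (Finset.subset_erase.2 ⟨hTS, hkT⟩) hN
        (by rw [Finset.card_erase_of_mem hkS]; omega)
      exact ⟨N', hN', hN'N.trans hNM⟩

end Reduction

/-! ### Plane rotations -/

section Rotations

variable {X ι : Type*} [TopologicalSpace X] [Fintype ι] [DecidableEq ι]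

/-- The matrix of the rotation by `z` in the plane of the `i`-th and `j`-th coordinates. -/
def rotationMatrix {ι : Type*} [DecidableEq ι] (i j : ι) (z : Circle) : Matrix ι ι ℝ :=
  1 + ((z : ℂ).re - 1) • (single i i 1 + single j j 1) +
    (z : ℂ).im • (single j i 1 - single i j 1)

theorem rotationMatrix_one {ι : Type*} [DecidableEq ι] (i j : ι) : rotationMatrix i j 1 = 1 := by
  simp [rotationMatrix]

theorem rotationMatrix_transpose {ι : Type*} [DecidableEq ι] (i j : ι) (z : Circle) :
    (rotationMatrix i j z)ᵀ = rotationMatrix i j z⁻¹ := by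
  simp only [rotationMatrix, transpose_add, transpose_sub, transpose_smul, transpose_one,
    transpose_single, Circle.coe_inv_eq_conj, Complex.conj_re, Complex.conj_im]
  module

theorem rotationMatrix_mul {i j : ι} (h : i ≠ j) (z w : Circle) :
    rotationMatrix i j (z * w) = rotationMatrix i j z * rotationMatrix i j w := by
  simp only [rotationMatrix, Circle.coe_mul, Complex.mul_re, Complex.mul_im, mul_add, add_mul,
    mul_sub, sub_mul, mul_one, one_mul, smul_mul_assoc, mul_smul_comm, single_mul_single_same,
    single_mul_single_of_ne, h, h.symm, ne_eq, not_false_eq_true]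
  module

theorem det_rotationMatrix {i j : ι} (h : i ≠ j) (z : Circle) : (rotationMatrix i j z).det = 1 := by
  -- The matrix is the square of an orthogonal matrix.
  obtain ⟨y, rfl⟩ : ∃ y : Circle, y * y = z :=
    ⟨Circle.exp ((z : ℂ).arg / 2), by rw [← Circle.exp_add, add_halves, Circle.exp_arg]⟩
  have h1 := congrArg det (rotationMatrix_mul h y y⁻¹)
  rw [mul_inv_cancel, rotationMatrix_one, det_one, ← rotationMatrix_transpose, det_mul,
    det_transpose] at h1
  rw [rotationMatrix_mul h, det_mul, ← h1]

/-- The rotations in the plane of the `i`-th and `j`-th coordinates. -/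
noncomputable def rotationHom {i j : ι} (h : i ≠ j) : Circle →* SpecialLinearGroup ι ℝ where
  toFun z := ⟨rotationMatrix i j z, det_rotationMatrix h z⟩
  map_one' := Subtype.ext (rotationMatrix_one i j)
  map_mul' z w := Subtype.ext (rotationMatrix_mul h z w)

theorem continuous_rotationHom {i j : ι} (h : i ≠ j) : Continuous (rotationHom h) := by
  refine Continuous.subtype_mk ?_ _
  have hre : Continuous fun z : Circle => (z : ℂ).re :=
    Complex.continuous_re.comp continuous_subtype_val
  have him : Continuous fun z : Circle => (z : ℂ).im :=
    Complex.continuous_im.comp continuous_subtype_val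
  unfold rotationMatrix
  fun_prop

/-- The family of plane rotations by the angles `z(x)`. -/
noncomputable def rotationMap {i j : ι} (h : i ≠ j) (z : C(X, Circle)) :
    C(X, SpecialLinearGroup ι ℝ) :=
  ⟨fun x => rotationHom h (z x), (continuous_rotationHom h).comp z.continuous⟩

theorem rotationMap_mul {i j : ι} (h : i ≠ j) (z w : C(X, Circle)) :
    rotationMap h (z * w) = rotationMap h z * rotationMap h w :=
  ContinuousMap.ext fun x => map_mul (rotationHom h) (z x) (w x)

theorem rotationMatrix_mulVec_single {i j : ι} (h : i ≠ j) (z : Circle) :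
    rotationMatrix i j z *ᵥ Pi.single i 1 =
      (z : ℂ).re • Pi.single i 1 + (z : ℂ).im • Pi.single j 1 := by
  simp only [rotationMatrix, add_mulVec, sub_mulVec, smul_mulVec, one_mulVec, single_mulVec_eq,
    Pi.single_eq_same, Pi.single_eq_of_ne h.symm, mul_one, mul_zero]
  module

theorem rotationMatrix_mulVec_single_of_ne {i j k : ι} (hi : i ≠ k) (hj : j ≠ k) (z : Circle) :
    rotationMatrix i j z *ᵥ Pi.single k 1 = Pi.single k 1 := by
  simp [rotationMatrix, add_mulVec, sub_mulVec, smul_mulVec, single_mulVec_eq,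
    Pi.single_eq_of_ne hi, Pi.single_eq_of_ne hj, -mulVec_single]

theorem rotationMap_mem_supportedSubgroup {i j : ι} (h : i ≠ j) (z : C(X, Circle)) (x : X) :
    rotationMap h z x ∈ supportedSubgroup {i, j} := fun k hk => by
  simp only [Finset.mem_insert, Finset.mem_singleton, not_or] at hk
  change rotationMatrix i j (z x) *ᵥ _ = _ ∧ _ ᵥ* rotationMatrix i j (z x) = _
  rw [← mulVec_transpose, rotationMatrix_transpose]
  exact ⟨rotationMatrix_mulVec_single_of_ne (Ne.symm hk.1) (Ne.symm hk.2) _,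
    rotationMatrix_mulVec_single_of_ne (Ne.symm hk.1) (Ne.symm hk.2) _⟩

/-- The Weyl element `(1 + a) (1 - b) (1 + a)` squares to `-1` on the plane cut out by the
idempotent `a b + b a`. -/
theorem weyl_sq {R : Type*} [Ring R] {a b : R} (ha : a * a = 0) (hb : b * b = 0)
    (hab : a * b * a = a) (hba : b * a * b = b) :
    ((1 + a) * (1 - b) * (1 + a)) * ((1 + a) * (1 - b) * (1 + a)) = 1 - 2 * (a * b + b * a) := by
  have h1 : (1 + a) * (1 - b) * (1 + a) = 1 + a - b - a * b - b * a := by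
    have : (1 + a) * (1 - b) * (1 + a) =
      1 + a + a - b - a * b - b * a + a * a - a * b * a := by noncomm_ring
    rw [this, ha, hab]
    noncomm_ring
  rw [h1]
  have : (1 + a - b - a * b - b * a) * (1 + a - b - a * b - b * a) =
      1 + a + a - b - b - 3 * (a * b + b * a) + a * a + b * b - 2 * (a * b * a) +
        2 * (b * a * b) - (a * a) * b - b * (a * a) + (b * b) * a + a * (b * b) +
        (a * b * a) * b + a * (b * b) * a + b * (a * a) * b + b * a * b * a := by noncomm_ring
  rw [this, ha, hb, hab, hba]
  noncomm_ring

/-- Conjugation by the diagonal matrix with entries `-1` at `j` and at a third index `l` inverts the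
rotations in the `(i, j)`-plane, and this diagonal matrix is a product of transvections. -/
theorem exists_conj_rotationMap_eq_inv {i j l : ι} (hij : i ≠ j) (hil : i ≠ l) (hjl : j ≠ l) :
    ∃ g ∈ elementaryMaps X ι, ∀ z : C(X, Circle),
      g * rotationMap hij z = (rotationMap hij z)⁻¹ * g := by
  have hmem (p q : ι) (hpq : p ≠ q) (c : ℝ) : ∃ T ∈ elementaryMaps X ι,
      ∀ x, (T x : Matrix ι ι ℝ) = 1 + single p q c :=
    ⟨_, transvectionMap_mem (ContinuousMap.const X (Pi.single p c))
      (ContinuousMap.const X (Pi.single q 1)) fun x => by simp [hpq.symm], fun x => by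
        rw [transvectionMap_apply]
        congr 1
        ext r s
        simp only [vecMulVec_apply, single_apply, Pi.single_apply, ContinuousMap.const_apply]
        grind⟩
  obtain ⟨T, hT, hTx⟩ := hmem j l hjl 1
  obtain ⟨T', hT', hTx'⟩ := hmem l j hjl.symm (-1)
  have hw : T * T' * T ∈ elementaryMaps X ι := mul_mem (mul_mem hT hT') hT
  refine ⟨(T * T' * T) * (T * T' * T), mul_mem hw hw, fun z => ?_⟩
  have hab : single j l (1 : ℝ) * single l j 1 = single j j 1 := by simp
  have hba : single l j (1 : ℝ) * single j l 1 = single l l 1 := by simp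
  have hD (x : X) : ((T x : Matrix ι ι ℝ) * (T' x : Matrix ι ι ℝ) * (T x : Matrix ι ι ℝ)) *
      ((T x : Matrix ι ι ℝ) * (T' x : Matrix ι ι ℝ) * (T x : Matrix ι ι ℝ)) =
      1 - (2 : ℝ) • (single j j 1 + single l l 1) := by
    have hneg : single l j (-1 : ℝ) = -single l j 1 := (single_neg l j 1).symm
    rw [hTx, hTx', hneg, ← sub_eq_add_neg, weyl_sq (by simp [hjl.symm]) (by simp [hjl])
      (by simp) (by simp), hab, hba, two_mul, two_smul]
  rw [eq_comm, inv_mul_eq_iff_eq_mul, eq_comm]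
  ext1 x
  apply Subtype.ext
  change rotationMatrix i j (z x) * (((T x : Matrix ι ι ℝ) * (T' x : Matrix ι ι ℝ) *
    (T x : Matrix ι ι ℝ)) * ((T x : Matrix ι ι ℝ) * (T' x : Matrix ι ι ℝ) * (T x : Matrix ι ι ℝ)) *
    rotationMatrix i j (z x)) = ((T x : Matrix ι ι ℝ) * (T' x : Matrix ι ι ℝ) *
    (T x : Matrix ι ι ℝ)) * ((T x : Matrix ι ι ℝ) * (T' x : Matrix ι ι ℝ) * (T x : Matrix ι ι ℝ))
  rw [hD]
  have hcomm : (1 - (2 : ℝ) • (single j j 1 + single l l 1)) * rotationMatrix i j (z x) =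
      rotationMatrix i j (z x)⁻¹ * (1 - (2 : ℝ) • (single j j 1 + single l l 1)) := by
    simp only [rotationMatrix, Circle.coe_inv_eq_conj, Complex.conj_re, Complex.conj_im, mul_add,
      add_mul, mul_sub, sub_mul, mul_one, one_mul, smul_mul_assoc, mul_smul_comm,
      single_mul_single_same, single_mul_single_of_ne, hij, hij.symm, hil, hil.symm, hjl, hjl.symm,
      ne_eq, not_false_eq_true]
    module
  rw [hcomm, ← Matrix.mul_assoc, ← rotationMatrix_mul hij, mul_inv_cancel, rotationMatrix_one,
    Matrix.one_mul]

/-- Modulo the elementary maps, a family of plane rotations is equal to its inverse. -/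
theorem rotationMap_mul_self_mem {i j l : ι} (hij : i ≠ j) (hil : i ≠ l) (hjl : j ≠ l)
    (z : C(X, Circle)) : rotationMap hij (z * z) ∈ elementaryMaps X ι := by
  obtain ⟨g, hg, h⟩ := exists_conj_rotationMap_eq_inv (X := X) hij hil hjl
  have h' := congrArg (QuotientGroup.mk (s := elementaryMaps X ι)) (h z)
  rw [QuotientGroup.mk_mul, QuotientGroup.mk_mul, QuotientGroup.mk_inv,
    (QuotientGroup.eq_one_iff g).2 hg, one_mul, mul_one, eq_inv_iff_mul_eq_one] at h'
  rw [← QuotientGroup.eq_one_iff, rotationMap_mul, QuotientGroup.mk_mul, h']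

end Rotations

/-! ### Loops in the rotation group of a plane -/

section PlaneLoops

/-- The vectors with `i`-th coordinate `p(x)`, `j`-th coordinate `q(x)` and all others zero. -/
def planeVector {X ι : Type*} [TopologicalSpace X] [DecidableEq ι] (i j : ι)
    (p q : C(X, ℝ)) : C(X, ι → ℝ) :=
  ⟨fun x => p x • Pi.single i 1 + q x • Pi.single j 1, by fun_prop⟩

theorem planeVector_apply_of_notMem {X ι : Type*} [TopologicalSpace X] [DecidableEq ι] {i j : ι}
    (p q : C(X, ℝ)) (x : X) {k : ι} (hk : k ∉ ({i, j} : Finset ι)) : planeVector i j p q x k = 0 := by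
  simp only [Finset.mem_insert, Finset.mem_singleton, not_or] at hk
  simp [planeVector, hk.1, hk.2]

variable {X ι : Type*} [TopologicalSpace X] [Fintype ι] [DecidableEq ι]

theorem planeVector_dotProduct {i j : ι} (h : i ≠ j) (p q p' q' : C(X, ℝ)) (x : X) :
    planeVector i j p q x ⬝ᵥ planeVector i j p' q' x = p x * p' x + q x * q' x := by
  simp [planeVector, h, h.symm, mul_comm]

/-- A nowhere vanishing family of vectors in a coordinate plane can be normalized by two
transvections of the plane, by way of the sum of `v` and its rotation by a right angle. -/
theorem exists_mulVec_planeVector_eq_normalized {i j : ι} (h : i ≠ j) (p q r : C(X, ℝ))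
    (hr : ∀ x, r x ≠ 0) (hpq : ∀ x, p x ^ 2 + q x ^ 2 = r x ^ 2) :
    ∃ T ∈ elementaryMaps X ι, (∀ x, T x ∈ supportedSubgroup {i, j}) ∧
      ∀ x, (T x : Matrix ι ι ℝ) *ᵥ planeVector i j p q x =
        (p x / r x) • Pi.single i 1 + (q x / r x) • Pi.single j 1 := by
  let s : C(X, ℝ) := ⟨fun x => (r x)⁻¹, r.continuous.inv₀ hr⟩
  -- With `J` the right-angle rotation, the functional `s v + c J v` takes the value `1` on both
  -- `v + J v` and `s v`, since `|v|² = s⁻²`.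
  let c : C(X, ℝ) := s ^ 2 - s
  have hs (x : X) : s x * r x = 1 := inv_mul_cancel₀ (hr x)
  have hs2 (x : X) : s x ^ 2 * (p x ^ 2 + q x ^ 2) = 1 := by
    rw [hpq, ← mul_pow, hs, one_pow]
  obtain ⟨T₁, hT₁, hT₁S, hT₁v⟩ := exists_transvection_mulVec_eq (S := {i, j})
    (planeVector i j p q) (planeVector i j (p - q) (q + p))
    (planeVector i j (s ^ 2 * p) (s ^ 2 * q))
    (fun x => by
      rw [planeVector_dotProduct h, ← hs2 x]
      simp only [ContinuousMap.mul_apply, ContinuousMap.pow_apply]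
      ring)
    (fun x => by
      rw [planeVector_dotProduct h, ← hs2 x]
      simp only [ContinuousMap.mul_apply, ContinuousMap.pow_apply, ContinuousMap.sub_apply,
        ContinuousMap.add_apply]
      ring)
    (fun x k => planeVector_apply_of_notMem _ _ x) (fun x k => planeVector_apply_of_notMem _ _ x)
    (fun x k => planeVector_apply_of_notMem _ _ x)
  obtain ⟨T₂, hT₂, hT₂S, hT₂v⟩ := exists_transvection_mulVec_eq (S := {i, j})
    (planeVector i j (p - q) (q + p)) (planeVector i j (s * p) (s * q))
    (planeVector i j (s * p - c * q) (s * q + c * p))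
    (fun x => by
      rw [planeVector_dotProduct h, ← hs2 x]
      simp only [c, ContinuousMap.mul_apply, ContinuousMap.pow_apply, ContinuousMap.sub_apply,
        ContinuousMap.add_apply]
      ring)
    (fun x => by
      rw [planeVector_dotProduct h, ← hs2 x]
      simp only [c, ContinuousMap.mul_apply, ContinuousMap.pow_apply, ContinuousMap.sub_apply,
        ContinuousMap.add_apply]
      ring)
    (fun x k => planeVector_apply_of_notMem _ _ x) (fun x k => planeVector_apply_of_notMem _ _ x)
    (fun x k => planeVector_apply_of_notMem _ _ x)
  refine ⟨T₂ * T₁, mul_mem hT₂ hT₁, fun x => mul_mem (hT₂S x) (hT₁S x), fun x => ?_⟩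
  change ((T₂ x : Matrix ι ι ℝ) * (T₁ x : Matrix ι ι ℝ)) *ᵥ _ = _
  rw [← mulVec_mulVec, hT₁v, hT₂v, div_eq_inv_mul, div_eq_inv_mul]
  rfl

/-- Modulo the elementary maps, a family of matrices supported on a plane is a family of
rotations. -/
theorem exists_mk_rotationMap_eq {i j : ι} (h : i ≠ j) {M : C(X, SpecialLinearGroup ι ℝ)}
    (hM : ∀ x, M x ∈ supportedSubgroup {i, j}) :
    ∃ z : C(X, Circle),
      (QuotientGroup.mk (rotationMap h z) : C(X, SpecialLinearGroup ι ℝ) ⧸ elementaryMaps X ι) =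
        QuotientGroup.mk M := by
  have hc (k l : ι) : Continuous fun x => (M x : Matrix ι ι ℝ) k l :=
    (continuous_coe_matrix M).matrix_elem k l
  let p : C(X, ℝ) := ⟨_, hc i i⟩
  let q : C(X, ℝ) := ⟨_, hc j i⟩
  have hcol (x : X) : (M x : Matrix ι ι ℝ) *ᵥ Pi.single i 1 = planeVector i j p q x := by
    rw [mulVec_single_one]
    funext k
    by_cases hk : k ∈ ({i, j} : Finset ι)
    · rcases Finset.mem_insert.1 hk with rfl | hk
      · simp [planeVector, p, h]
      · rw [Finset.mem_singleton] at hk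
        subst hk
        simp [planeVector, q, h.symm]
    · rw [planeVector_apply_of_notMem _ _ _ hk]
      exact (apply_eq_zero_of_mem_supportedSubgroup (hM x) hk (by simp)).1
  have hpos (x : X) : 0 < p x ^ 2 + q x ^ 2 := by
    refine lt_of_le_of_ne (by positivity) fun h0 => ?_
    have hp : p x = 0 := by nlinarith [sq_nonneg (p x), sq_nonneg (q x)]
    have hq : q x = 0 := by nlinarith [sq_nonneg (p x), sq_nonneg (q x)]
    have h1 : (↑(M x)⁻¹ : Matrix ι ι ℝ) *ᵥ ((M x : Matrix ι ι ℝ) *ᵥ Pi.single i 1) =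
        Pi.single i 1 := by
      rw [mulVec_mulVec, SpecialLinearGroup.inv_mul_coe, one_mulVec]
    rw [hcol] at h1
    have h2 : planeVector i j p q x = 0 := by simp [planeVector, hp, hq]
    rw [h2, mulVec_zero] at h1
    simpa using congrFun h1 i
  let r : C(X, ℝ) := ⟨fun x => √(p x ^ 2 + q x ^ 2), by fun_prop⟩
  have hr (x : X) : r x ≠ 0 := (Real.sqrt_pos.2 (hpos x)).ne'
  have hr2 (x : X) : p x ^ 2 + q x ^ 2 = r x ^ 2 := (Real.sq_sqrt (hpos x).le).symm
  obtain ⟨T, hT, hTS, hTv⟩ := exists_mulVec_planeVector_eq_normalized h p q r hr hr2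
  let z : C(X, Circle) := ⟨fun x => ⟨⟨p x / r x, q x / r x⟩, by
      refine mem_sphere_zero_iff_norm.2 ?_
      rw [← pow_eq_one_iff_of_nonneg (norm_nonneg _) two_ne_zero, Complex.sq_norm,
        Complex.normSq_mk]
      have := hr x
      have := hr2 x
      field_simp
      linarith⟩, by
    refine Continuous.subtype_mk ?_ _
    have h1 : Continuous fun x => p x / r x := p.continuous.div r.continuous hr
    have h2 : Continuous fun x => q x / r x := q.continuous.div r.continuous hr
    exact Complex.equivRealProdCLM.symm.continuous.comp (h1.prodMk h2)⟩
  refine ⟨z, ?_⟩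
  obtain ⟨N, hN, hNM⟩ := exists_mk_eq_supported_erase_of_column
    (M := (rotationMap h z)⁻¹ * (T * M)) (S := {i, j}) (k := i) (by simp)
    (fun x => mul_mem (inv_mem (rotationMap_mem_supportedSubgroup h z x))
      (mul_mem (hTS x) (hM x))) (fun x => by
        have hcol' : (T x : Matrix ι ι ℝ) *ᵥ ((M x : Matrix ι ι ℝ) *ᵥ Pi.single i 1) =
            (rotationMap h z x : Matrix ι ι ℝ) *ᵥ Pi.single i 1 := by
          rw [hcol, hTv]
          exact (rotationMatrix_mulVec_single h (z x)).symm
        change ((↑(rotationMap h z x)⁻¹ : Matrix ι ι ℝ) *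
          ((T x : Matrix ι ι ℝ) * (M x : Matrix ι ι ℝ))) *ᵥ _ = _
        rw [← mulVec_mulVec, ← mulVec_mulVec, hcol', mulVec_mulVec,
          SpecialLinearGroup.inv_mul_coe, one_mulVec])
  have hN1 : N = 1 := ContinuousMap.ext fun x => supportedSubgroup_singleton (k := j) (by
    have := hN x
    rwa [Finset.erase_insert (by simpa using h)] at this)
  rw [hN1, QuotientGroup.mk_one, QuotientGroup.mk_mul, QuotientGroup.mk_inv, QuotientGroup.mk_mul,
    (QuotientGroup.eq_one_iff T).2 hT, one_mul, eq_comm, inv_mul_eq_one] at hNM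
  exact hNM

/-- The composition of a map from the circle to itself with the doubling map is a square. If `g` is
a lift of `z` to the reals, a square root of `z (2 t)` is `exp (i g(2 t) / 2)`: since
`g (t + 1) - g t` is constant with values in `2πℤ`, this is `1`-periodic in `t`. -/
theorem exists_mul_self_eq_double (z : C(UnitAddCircle, Circle)) :
    ∃ y : C(UnitAddCircle, Circle), ∀ x, z ((2 : ℕ) • x) = y x * y x := by
  have hπ : Continuous fun t : ℝ => (t : UnitAddCircle) := AddCircle.continuous_mk' 1
  obtain ⟨e₀, he₀⟩ : ∃ e₀, Circle.exp e₀ = z ((0 : ℝ) : UnitAddCircle) :=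
    ⟨_, Circle.exp_arg _⟩
  obtain ⟨g, ⟨-, hg⟩, -⟩ := Circle.isCoveringMap_exp.existsUnique_continuousMap_lifts
    (z.comp ⟨_, hπ⟩) (0 : ℝ) e₀ he₀
  have hg' (t : ℝ) : Circle.exp (g t) = z t := congrFun hg t
  have hexp (t : ℝ) : Circle.exp (g (t + 1) - g t) = 1 := by
    rw [Circle.exp_sub, hg', hg', AddCircle.coe_add, AddCircle.coe_period, add_zero, div_self']
  have hconst (s t : ℝ) : g (s + 1) - g s = g (t + 1) - g t :=
    Circle.isCoveringMap_exp.const_of_comp (g := fun t => g (t + 1) - g t) (by fun_prop)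
      (fun s t => (hexp s).trans (hexp t).symm) s t
  let f : ℝ → Circle := fun t => Circle.exp (g (2 * t) / 2)
  have hf : Function.Periodic f 1 := fun t => by
    have h1 : g (2 * (t + 1)) / 2 = g (2 * t) / 2 + (g (0 + 1) - g 0) := by
      have h2 := hconst (2 * t) 0
      have h3 := hconst (2 * t + 1) 0
      rw [show 2 * (t + 1) = 2 * t + 1 + 1 by ring, ← sub_eq_iff_eq_add', ← sub_div,
        ← sub_add_sub_cancel _ (g (2 * t + 1)), h2, h3, add_self_div_two]
    simp only [f]
    rw [h1, Circle.exp_add, hexp, mul_one]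
  have hfc : Continuous f := Circle.exp.continuous.comp (by fun_prop)
  refine ⟨⟨hf.lift, continuous_coinduced_dom.2 hfc⟩, fun x => ?_⟩
  induction x using QuotientAddGroup.induction_on with
  | H t =>
    change z ((2 : ℕ) • (t : UnitAddCircle)) = f t * f t
    simp only [f]
    rw [← Circle.exp_add, add_halves, hg', two_mul, two_nsmul, AddCircle.coe_add]

end PlaneLoops

/-! ### Loops traversed twice -/

/-- In dimension at least three, every loop in `SL` traversed twice is a product of transvections
with continuous coefficients. -/
theorem comp_double_mem_elementaryMaps {d : ℕ} (hd : 3 ≤ d)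
    (A : C(UnitAddCircle, SL(d, ℝ))) (D : C(UnitAddCircle, UnitAddCircle))
    (hD : ∀ x, D x = (2 : ℕ) • x) : A.comp D ∈ elementaryMaps UnitAddCircle (Fin d) := by
  let i : Fin d := ⟨0, by omega⟩
  let j : Fin d := ⟨1, by omega⟩
  let l : Fin d := ⟨2, by omega⟩
  have hij : i ≠ j := by simp [i, j]
  have hil : i ≠ l := by simp [i, l]
  have hjl : j ≠ l := by simp [j, l]
  obtain ⟨N, hN, hNA⟩ := exists_mk_eq_supported (T := {i, j}) (Finset.subset_univ _)
    (Finset.card_pair hij) (M := A) fun x k hk => absurd (Finset.mem_univ k) hk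
  obtain ⟨z, hz⟩ := exists_mk_rotationMap_eq hij hN
  have h := comp_mem_elementaryMaps (QuotientGroup.eq.1 (hz.trans hNA)) D
  obtain ⟨y, hy⟩ := exists_mul_self_eq_double z
  have hyD : (rotationMap hij z).comp D = rotationMap hij (y * y) := ContinuousMap.ext fun x => by
    change rotationHom hij (z (D x)) = rotationHom hij (y x * y x)
    rw [hD, hy]
  rw [ContinuousMap.mul_comp, ContinuousMap.inv_comp, hyD] at h
  exact (Subgroup.mul_mem_cancel_left _ (inv_mem (rotationMap_mul_self_mem hij hil hjl y))).1 h

theorem zpow_apply_of_semiconj {Θ Θ' : Type*} [TopologicalSpace Θ] [TopologicalSpace Θ']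
    {φ : Θ ≃ₜ Θ} {ψ : Θ' ≃ₜ Θ'} {f : Θ → Θ'} (h : ∀ θ, f (φ θ) = ψ (f θ)) (n : ℤ) (θ : Θ) :
    f ((φ ^ n) θ) = (ψ ^ n) (f θ) := by
  induction n generalizing θ with
  | zero => rfl
  | succ n ih => rw [← zpow_one_add_apply, ih, h, zpow_one_add_apply]
  | pred n ih =>
    obtain ⟨θ, rfl⟩ := φ.surjective θ
    rw [zpow_one_add_apply, h, zpow_one_add_apply, sub_add_cancel, ih]

theorem nStep_comp_of_semiconj {Θ Θ' : Type*} [TopologicalSpace Θ] [TopologicalSpace Θ'] {d : ℕ}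
    {φ : Θ ≃ₜ Θ} {ψ : Θ' ≃ₜ Θ'} (A : C(Θ', SL(d, ℝ))) (f : C(Θ, Θ'))
    (h : ∀ θ, f (φ θ) = ψ (f θ)) (n : ℤ) (θ : Θ) :
    nStep φ (A.comp f) n θ = nStep ψ A n (f θ) := by
  induction n with
  | zero => rfl
  | succ n ih =>
    rw [nStep_add_one, nStep_add_one, ih, ContinuousMap.comp_apply, zpow_apply_of_semiconj h]
  | pred n ih =>
    have h1 := nStep_add_one φ (A.comp f) (-(n : ℤ) - 1) θ
    have h2 := nStep_add_one ψ A (-(n : ℤ) - 1) (f θ)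
    rw [sub_add_cancel, ContinuousMap.comp_apply, zpow_apply_of_semiconj h] at h1
    rw [sub_add_cancel] at h2
    rw [h2, h1] at ih
    exact mul_left_cancel ih

theorem corollary3p4 (d : ℕ) (hd : 3 ≤ d) (α : ℝ) (A : C(UnitAddCircle, SL(d, ℝ))) :
    ∃ Φ : ContinuousTimeCocycle d (circleRotation (α / 2)),
      ∀ (n : ℤ) (θ : UnitAddCircle),
        Φ.toMap (MappingTorus.mk (circleRotation (α / 2)) θ 0, (n : ℝ)) =
          nStep (circleRotation α) A n ((2 : ℕ) • θ) := by
  let D : C(UnitAddCircle, UnitAddCircle) := ⟨fun θ => (2 : ℕ) • θ, continuous_nsmul 2⟩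
  obtain ⟨P⟩ := nonempty_smoothContraction
    (comp_double_mem_elementaryMaps hd A D fun _ => rfl)
  refine ⟨P.suspension (circleRotation (α / 2)), fun n θ => ?_⟩
  rw [P.suspension_toMap_intCast]
  refine nStep_comp_of_semiconj A D (fun θ => ?_) n θ
  change (2 : ℕ) • (θ + ((α / 2 : ℝ) : UnitAddCircle)) = (2 : ℕ) • θ + (α : UnitAddCircle)
  rw [nsmul_add, ← AddCircle.coe_nsmul, nsmul_eq_mul, Nat.cast_ofNat,
    mul_div_cancel₀ α two_ne_zero]
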